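/- There exist absolute constants $C_1,C_2>0$ with the following property. Let $m,d,n\in\mathbb N$, let $A$ be a real $m\times d$ matrix that is injective and has spectral norm $\|A\|=1$, and let $X\in\mathbb R^d$ and $W\in\mathbb R^m$ be independent random vectors with $\|X\|_{\psi_2}=1$, $\|W\|_{\psi_2}=1/\sqrt2$, $\mathbb E[W]=0$, where $$\|\xi\|_{\psi_2}=\sup_{\|v\|=1}\ \sup_{q\ge 1} q^{-1/2}\,\mathbb E\big[|\langle \xi,v\rangle|^q\big]^{1/q}.$$ Write $\Sigma_\xi=\mathbb E[\xi\otimes\xi]$ for the noncentered covariance matrix of $\xi$, and suppose that the noise is isotropic, $\Sigma_W=\mathrm{Id}$. Let $0<\sigma<\sqrt2$ and $Y=AX+\sigma W$. Let $h=\operatorname{rank}\Sigma_X$, let $\lambda_{\min}$ be the smallest non-zero eigenvalue of $\Sigma_{AX}$, and let $\Pi$ be the orthogonal projection of $\mathbb R^m$ onto the range of $\Sigma_{AX}$. Let $Y_i=AX_i+\sigma W_i$, $i=1,\dots,n$, be independent, where each pair $(X_i,W_i)$ is distributed as $(X,W)$; let $\widehat\Sigma=\frac1n\sum_{i=1}^n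 Y_i\otimes Y_i$, and let $\widehat\Pi$ be the orthogonal projection onto the span of the first $h$ eigenvectors of $\widehat\Sigma$, that is, of the first $h$ vectors of an orthonormal eigenbasis whose (repeated) eigenvalues are in nonincreasing order (any such eigenbasis may be chosen, for each outcome, if it is not unique). Let $\tau>0$. If $$n\ \ge\ C_1\,(\sqrt m+\tau)^2\max\Big\{1,\frac{16}{\lambda_{\min}^2}\Big\}\qquad\text{and}\qquad \sigma^2<\frac{\lambda_{\min}}2,$$ then, with probability greater than $1-2e^{-\tau^2}$, $$\|\widehat\Pi-\Pi\|\ \le\ \frac{C_2}{\lambda_{\min}}\Big(\sqrt{\frac mn}+\frac{\tau}{\sqrt n}\Big),$$ where $\|\cdot\|$ is the spectral norm. (Precisely: the inequality holds on a measurable event of probability greater than $1-2e^{-\tau^2}$.) -/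

import Mathlib

open MeasureTheory ProbabilityTheory
open scoped ENNReal Matrix.Norms.L2Operator

noncomputable section

namespace InverseProblem

/-- The noncentered covariance matrix `E[ξ ⊗ ξ]` of a random vector `ξ` in `ℝᵏ`. -/
def secondMoment {Ω : Type*} [MeasurableSpace Ω] {k : ℕ}
    (ξ : Ω → EuclideanSpace ℝ (Fin k)) (P : Measure Ω) : Matrix (Fin k) (Fin k) ℝ :=
  Matrix.of fun i j => ∫ ω, ξ ω i * ξ ω j ∂P

/-- The sub-gaussian norm of a random vector: the supremum over unit vectors `v` and real `q ≥ 1` of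
`q ^ (-1/2) * E[|⟨ξ, v⟩| ^ q] ^ (1/q)`, as an element of `[0, ∞]`. -/
def psi2Norm {Ω : Type*} [MeasurableSpace Ω] {k : ℕ}
    (ξ : Ω → EuclideanSpace ℝ (Fin k)) (P : Measure Ω) : ℝ≥0∞ :=
  ⨆ (v : EuclideanSpace ℝ (Fin k)) (_ : ‖v‖ = 1) (q : ℝ) (_ : 1 ≤ q),
    ENNReal.ofReal (q ^ (-(1 / 2) : ℝ)) *
      eLpNorm (fun ω => inner ℝ (ξ ω) v) (ENNReal.ofReal q) P

/-- The random vector `A ξ`. -/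
def image {Ω : Type*} {m d : ℕ} (A : Matrix (Fin m) (Fin d) ℝ)
    (X : Ω → EuclideanSpace ℝ (Fin d)) : Ω → EuclideanSpace ℝ (Fin m) :=
  fun ω => Matrix.toEuclideanLin A (X ω)

/-- The datum `Y = A X + σ W`. -/
def observation {Ω : Type*} {m d : ℕ} (A : Matrix (Fin m) (Fin d) ℝ) (σ : ℝ)
    (X : Ω → EuclideanSpace ℝ (Fin d)) (W : Ω → EuclideanSpace ℝ (Fin m)) :
    Ω → EuclideanSpace ℝ (Fin m) :=
  fun ω => image A X ω + σ • W ω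

/-- The standing assumptions on the statistical linear inverse problem `Y = A X + σ W`. The norm of
the matrix `A` is its spectral norm. -/
structure StandingAssumptions {Ω : Type*} [MeasurableSpace Ω] {m d : ℕ}
    (A : Matrix (Fin m) (Fin d) ℝ) (σ : ℝ) (X : Ω → EuclideanSpace ℝ (Fin d))
    (W : Ω → EuclideanSpace ℝ (Fin m)) (P : Measure Ω) : Prop where
  norm_A : ‖A‖ = 1
  injective_A : Function.Injective (Matrix.toEuclideanLin A)
  measurable_X : Measurable X
  measurable_W : Measurable W
  psi2Norm_X : psi2Norm X P = 1
  psi2Norm_W : psi2Norm W P = ENNReal.ofReal (1 / √2)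
  centered_W : ∫ ω, W ω ∂P = 0
  indep : IndepFun X W P
  sigma_pos : 0 < σ
  sigma_lt : σ < √2

/-- The empirical covariance matrix `(1/n) ∑ₖ yₖ ⊗ yₖ`. -/
def empiricalCovariance {n m : ℕ} (y : Fin n → EuclideanSpace ℝ (Fin m)) :
    Matrix (Fin m) (Fin m) ℝ :=
  Matrix.of fun i j => (n : ℝ)⁻¹ * ∑ k, y k i * y k j

/-- The orthogonal projection of `ℝᵏ` onto the range of the matrix `S`. -/
def rangeProjection {k : ℕ} (S : Matrix (Fin k) (Fin k) ℝ) :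
    EuclideanSpace ℝ (Fin k) →L[ℝ] EuclideanSpace ℝ (Fin k) :=
  (LinearMap.range (Matrix.toEuclideanLin S)).starProjection

/-- `lam` is the smallest non-zero eigenvalue of `S`. -/
def IsSmallestNonzeroEigenvalue {k : ℕ} (S : Matrix (Fin k) (Fin k) ℝ) (lam : ℝ) : Prop :=
  IsLeast {t : ℝ | t ≠ 0 ∧ Module.End.HasEigenvalue (Matrix.toEuclideanLin S) t} lam

/-- `Q` is an orthogonal projection onto the span of the first `h` vectors of an orthonormal basis of
eigenvectors of `S`, where the (repeated) eigenvalues are in nonincreasing order. If the `h`-th and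
the `(h+1)`-th eigenvalue coincide, then several `Q` qualify. -/
def IsLeadingEigenprojection {k : ℕ} (S : Matrix (Fin k) (Fin k) ℝ) (h : ℕ)
    (Q : EuclideanSpace ℝ (Fin k) →L[ℝ] EuclideanSpace ℝ (Fin k)) : Prop :=
  ∃ (u : OrthonormalBasis (Fin k) ℝ (EuclideanSpace ℝ (Fin k))) (β : Fin k → ℝ),
    Antitone β ∧ (∀ i, Matrix.toEuclideanLin S (u i) = β i • u i) ∧
      Q = (Submodule.span ℝ (u '' {i | (i : ℕ) < h})).starProjection

/-- A leading eigenprojection of a symmetric matrix always exists. -/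
theorem exists_isLeadingEigenprojection {k : ℕ} {S : Matrix (Fin k) (Fin k) ℝ}
    (hS : S.IsHermitian) (h : ℕ) : ∃ Q, IsLeadingEigenprojection S h Q := by
  have hs : (Matrix.toEuclideanLin S).IsSymmetric := Matrix.isSymmetric_toEuclideanLin_iff.2 hS
  have hk : Module.finrank ℝ (EuclideanSpace ℝ (Fin k)) = k := by simp
  exact ⟨_, hs.eigenvectorBasis hk, hs.eigenvalues hk, hs.eigenvalues_antitone hk,
    fun i => hs.apply_eigenvectorBasis hk i, rfl⟩

end InverseProblem

end

/-! Since `W` is centered, isotropic and independent of `X`, the second moment of the datum is `Σ_Y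
= Σ_{AX} + σ² Id`. The noise shifts the spectrum without moving an eigenspace: the leading
eigenspace of `Σ_Y` is the range of `Σ_{AX}`, separated from the rest by the gap `λ_min`. Because
`A` is injective, its dimension is the rank of `Σ_X`. It remains to see how far the empirical
covariance `S` is from `Σ_Y`, and what this costs for the eigenspace.

Deterministic part (`norm_starProjection_sub_le`): if `‖S - Σ_Y‖ ≤ δ ≤ λ_min/2`, Weyl's inequalities
put the first `h` eigenvalues of `S` above `σ² + λ_min/2` and the others within `δ` of `σ²`, and a
Davis–Kahan argument gives distance at most `4δ/λ_min` between the projections.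

Probabilistic part (`StandingAssumptions.exists_event_empiricalCovariance`): the marginals `⟨Y, v⟩`
are sub-gaussian, so their squares are sub-exponential and Bernstein's inequality controls each
centered empirical quadratic form. A union bound over a net of at most `25 ^ m` vectors turns this
into an operator-norm bound with `δ` of order `(√m + τ)/√n`. The lower bound on `n` keeps Bernstein
in its sub-gaussian regime and ensures `δ ≤ λ_min/2`. -/

namespace InverseProblem
-- Perturbation of eigenvalues and eigenspaces.
section Perturbation

variable {E : Type*} [NormedAddCommGroup E] [InnerProductSpace ℝ E]

theorem exists_ne_zero_mem_of_finrank_lt [FiniteDimensional ℝ E]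
    (U V : Submodule ℝ E)
    (h : Module.finrank ℝ E < Module.finrank ℝ U + Module.finrank ℝ V) :
    ∃ x ∈ U, x ∈ V ∧ x ≠ 0 := by
  have h1 := Submodule.finrank_sup_add_finrank_inf_eq U V
  have h2 := Submodule.finrank_le (U ⊔ V)
  have h3 : U ⊓ V ≠ ⊥ := by
    intro h0
    rw [h0, finrank_bot] at h1
    omega
  obtain ⟨x, hx, hx0⟩ := Submodule.exists_mem_ne_zero_of_ne_bot h3
  exact ⟨x, hx.1, hx.2, hx0⟩

variable {k : ℕ} (u : OrthonormalBasis (Fin k) ℝ E)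

theorem finrank_span_image_orthonormalBasis (s : Finset (Fin k)) :
    Module.finrank ℝ (Submodule.span ℝ (u '' s)) = s.card := by
  have h : LinearIndependent ℝ (fun x : (s : Set (Fin k)) => u x) :=
    u.orthonormal.linearIndependent.comp _ Subtype.val_injective
  rw [Set.image_eq_range, finrank_span_eq_card h]
  simp

theorem inner_eq_zero_of_mem_span_image {s : Set (Fin k)} {x : E}
    (hx : x ∈ Submodule.span ℝ (u '' s)) {i : Fin k} (hi : i ∉ s) : inner ℝ (u i) x = 0 := by
  induction hx using Submodule.span_induction with
  | mem x hx =>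
    obtain ⟨j, hj, rfl⟩ := hx
    exact u.orthonormal.2 (by rintro rfl; exact hi hj)
  | zero => simp
  | add x y _ _ hx hy => simp [inner_add_right, hx, hy]
  | smul a x _ hx => simp [inner_smul_right, hx]

theorem inner_starProjection_span_image [FiniteDimensional ℝ E]
    (s : Set (Fin k)) [DecidablePred (· ∈ s)] (x : E)
    (i : Fin k) :
    inner ℝ (u i) ((Submodule.span ℝ (u '' s)).starProjection x) =
      if i ∈ s then inner ℝ (u i) x else 0 := by
  split_ifs with hi
  · rw [← Submodule.inner_starProjection_left_eq_right, Submodule.starProjection_eq_self_iff.2]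
    exact Submodule.subset_span ⟨i, hi, rfl⟩
  · exact inner_eq_zero_of_mem_span_image u (Submodule.starProjection_apply_mem _ _) hi

theorem sum_sq_inner_eq (x : E) : ∑ i, (inner ℝ (u i) x) ^ 2 = ‖x‖ ^ 2 := by
  rw [← u.sum_sq_norm_inner_right x]
  simp

theorem inner_apply_self_eq_sum {S : E →ₗ[ℝ] E} {β : Fin k → ℝ} (hS : ∀ i, S (u i) = β i • u i)
    (x : E) : inner ℝ (S x) x = ∑ i, β i * (inner ℝ (u i) x) ^ 2 := by
  nth_rewrite 1 [← u.sum_repr' x]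
  simp only [map_sum, map_smul, hS, sum_inner, inner_smul_left]
  refine Finset.sum_congr rfl fun i _ => ?_
  simp
  ring

theorem inner_apply_eq_mul {S : E →ₗ[ℝ] E} {β : Fin k → ℝ} (hS : ∀ i, S (u i) = β i • u i)
    (x : E) (i : Fin k) : inner ℝ (u i) (S x) = β i * inner ℝ (u i) x := by
  nth_rewrite 1 [← u.sum_repr' x]
  simp only [map_sum, map_smul, hS, inner_sum, inner_smul_right]
  rw [Finset.sum_eq_single i]
  · rw [real_inner_self_eq_norm_sq, u.orthonormal.1]; ring
  · intro j _ hj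
    rw [u.orthonormal.2 hj.symm]; ring
  · simp

/-- A symmetric operator is bounded below by its smallest nonzero eigenvalue on its range. -/
theorem le_inner_apply_self_of_mem_range [FiniteDimensional ℝ E]
    {T : E →ₗ[ℝ] E} (hT : T.IsSymmetric) {lam : ℝ}
    (hlam : ∀ t ≠ 0, Module.End.HasEigenvalue T t → lam ≤ t) {x : E}
    (hx : x ∈ LinearMap.range T) : lam * ‖x‖ ^ 2 ≤ inner ℝ (T x) x := by
  obtain ⟨y, rfl⟩ := hx
  set b := hT.eigenvectorBasis rfl
  have hb : ∀ i, T (b i) = hT.eigenvalues rfl i • b i := fun i => hT.apply_eigenvectorBasis rfl i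
  rw [inner_apply_self_eq_sum b hb, ← sum_sq_inner_eq b, Finset.mul_sum]
  refine Finset.sum_le_sum fun i _ => ?_
  by_cases h0 : hT.eigenvalues rfl i = 0
  · simp [inner_apply_eq_mul b hb, h0]
  · exact mul_le_mul_of_nonneg_right (hlam _ h0 (hT.hasEigenvalue_eigenvalues rfl i))
      (sq_nonneg _)

variable {T S : E →ₗ[ℝ] E} {lam c δ : ℝ} {β : Fin k → ℝ}

theorem apply_eq_zero_of_mem_range_orthogonal (hT : T.IsSymmetric) {x : E}
    (hx : x ∈ (LinearMap.range T)ᗮ) : T x = 0 := by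
  have h := hx (T (T x)) ⟨_, rfl⟩
  rw [hT] at h
  exact inner_self_eq_zero.1 h

/-- The component of `x` orthogonal to the range lies in the kernel of the symmetric `T`, so only
the component in the range contributes. -/
theorem inner_apply_self_nonneg_of_range [FiniteDimensional ℝ E]
    (hT : T.IsSymmetric) (hlam : 0 ≤ lam)
    (hpos : ∀ x ∈ LinearMap.range T, lam * ‖x‖ ^ 2 ≤ inner ℝ (T x) x) (x : E) :
    0 ≤ inner ℝ (T x) x := by
  set K := LinearMap.range T
  have hq : T (x - K.starProjection x) = 0 :=
    apply_eq_zero_of_mem_range_orthogonal hT (K.sub_starProjection_mem_orthogonal x)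
  have h1 : T x = T (K.starProjection x) := by
    rw [map_sub] at hq; exact sub_eq_zero.1 hq
  have h2 : inner ℝ (T x) x = inner ℝ (T (K.starProjection x)) (K.starProjection x) := by
    rw [hT, h1, ← hT, h1]
  rw [h2]
  exact le_trans (by positivity) (hpos _ (K.starProjection_apply_mem x))

theorem abs_inner_perturbation_le (hS : ∀ x, ‖S x - T x - c • x‖ ≤ δ * ‖x‖) (x : E) :
    |inner ℝ (S x) x - inner ℝ (T x) x - c * ‖x‖ ^ 2| ≤ δ * ‖x‖ ^ 2 := by
  have h : inner ℝ (S x) x - inner ℝ (T x) x - c * ‖x‖ ^ 2 = inner ℝ (S x - T x - c • x) x := by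
    simp [inner_sub_left, inner_smul_left]
  rw [h]
  calc _ ≤ ‖S x - T x - c • x‖ * ‖x‖ := abs_real_inner_le_norm _ _
    _ ≤ δ * ‖x‖ * ‖x‖ := by gcongr; exact hS x
    _ = _ := by ring

/-- Weyl's inequality for the leading eigenvalues of a perturbation of `T + c`. -/
theorem le_eigenvalue_of_lt_finrank_range [FiniteDimensional ℝ E]
    (hβ : Antitone β) (hu : ∀ i, S (u i) = β i • u i)
    (hpos : ∀ x ∈ LinearMap.range T, lam * ‖x‖ ^ 2 ≤ inner ℝ (T x) x)
    (hS : ∀ x, ‖S x - T x - c • x‖ ≤ δ * ‖x‖) {i : Fin k}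
    (hi : (i : ℕ) < Module.finrank ℝ (LinearMap.range T)) : c + lam - δ ≤ β i := by
  have hk : Module.finrank ℝ E = k := by simpa using Module.finrank_eq_card_basis u.toBasis
  -- The eigenvectors of index at least `i` span dimension `k - i` and the range has dimension
  -- greater than `i`, so they share some `x ≠ 0`. Its Rayleigh quotient for `S` is at most `β i`
  -- and at least `c + lam - δ`.
  obtain ⟨x, hx, hx', hx0⟩ := exists_ne_zero_mem_of_finrank_lt
    (Submodule.span ℝ (u '' (Finset.Ici i : Finset (Fin k)))) (LinearMap.range T) (by
      rw [finrank_span_image_orthonormalBasis, Fin.card_Ici, hk]; omega)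
  have h1 : inner ℝ (S x) x ≤ β i * ‖x‖ ^ 2 := by
    rw [inner_apply_self_eq_sum u hu, ← sum_sq_inner_eq u, Finset.mul_sum]
    refine Finset.sum_le_sum fun j _ => ?_
    by_cases hj : i ≤ j
    · exact mul_le_mul_of_nonneg_right (hβ hj) (sq_nonneg _)
    · rw [inner_eq_zero_of_mem_span_image u hx (by simpa using hj)]; simp
  have h2 := (abs_le.1 (abs_inner_perturbation_le hS x)).1
  have h3 := hpos x hx'
  have h4 : 0 < ‖x‖ ^ 2 := by positivity
  exact le_of_mul_le_mul_right (by nlinarith) h4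

/-- Weyl's inequality for the remaining eigenvalues of a perturbation of `T + c`. -/
theorem abs_eigenvalue_sub_le_of_finrank_range_le [FiniteDimensional ℝ E]
    (hβ : Antitone β)
    (hu : ∀ i, S (u i) = β i • u i) (hT : T.IsSymmetric) (hlam : 0 ≤ lam)
    (hpos : ∀ x ∈ LinearMap.range T, lam * ‖x‖ ^ 2 ≤ inner ℝ (T x) x)
    (hS : ∀ x, ‖S x - T x - c • x‖ ≤ δ * ‖x‖) {i : Fin k}
    (hi : Module.finrank ℝ (LinearMap.range T) ≤ i) : |β i - c| ≤ δ := by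
  have hk : Module.finrank ℝ E = k := by simpa using Module.finrank_eq_card_basis u.toBasis
  have hfr := Submodule.finrank_add_finrank_orthogonal (LinearMap.range T)
  -- Upper bound: the first `i + 1` eigenvectors meet the complement of the range, where `T`
  -- vanishes.
  obtain ⟨x, hx, hx', hx0⟩ := exists_ne_zero_mem_of_finrank_lt
    (Submodule.span ℝ (u '' (Finset.Iic i : Finset (Fin k)))) (LinearMap.range T)ᗮ (by
      rw [finrank_span_image_orthonormalBasis, Fin.card_Iic, hk]; omega)
  have h1 : β i * ‖x‖ ^ 2 ≤ inner ℝ (S x) x := by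
    rw [inner_apply_self_eq_sum u hu, ← sum_sq_inner_eq u, Finset.mul_sum]
    refine Finset.sum_le_sum fun j _ => ?_
    by_cases hj : j ≤ i
    · exact mul_le_mul_of_nonneg_right (hβ hj) (sq_nonneg _)
    · rw [inner_eq_zero_of_mem_span_image u hx (by simpa using hj)]; simp
  have h2 := (abs_le.1 (abs_inner_perturbation_le hS x)).2
  rw [apply_eq_zero_of_mem_range_orthogonal hT hx', inner_zero_left] at h2
  have h4 : 0 < ‖x‖ ^ 2 := by positivity
  -- The lower bound needs no dimension count: test at `u i` and use that `T` is nonnegative.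
  have h5 := (abs_le.1 (abs_inner_perturbation_le hS (u i))).1
  have h6 := inner_apply_self_nonneg_of_range hT hlam hpos (u i)
  rw [hu, inner_smul_left, real_inner_self_eq_norm_sq, u.orthonormal.1] at h5
  simp only [conj_trivial] at h5
  refine abs_le.2 ⟨by linarith, ?_⟩
  exact le_of_mul_le_mul_right (by nlinarith) h4

/-- A Davis–Kahan theorem: the leading eigenspace of a small perturbation of `T + c` is close to the
range of `T`. -/
theorem norm_starProjection_sub_le [FiniteDimensional ℝ E]
    (hβ : Antitone β) (hu : ∀ i, S (u i) = β i • u i)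
    (hT : T.IsSymmetric) (hlam : 0 < lam)
    (hpos : ∀ x ∈ LinearMap.range T, lam * ‖x‖ ^ 2 ≤ inner ℝ (T x) x)
    (hS : ∀ x, ‖S x - T x - c • x‖ ≤ δ * ‖x‖) (hδ0 : 0 ≤ δ) (hδ : δ ≤ lam / 2) :
    ‖(Submodule.span ℝ (u '' {i | (i : ℕ) < Module.finrank ℝ (LinearMap.range T)})).starProjection -
      (LinearMap.range T).starProjection‖ ≤ 4 * δ / lam := by
  set K := LinearMap.range T
  set U := Submodule.span ℝ (u '' {i | (i : ℕ) < Module.finrank ℝ K})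
  have hker : ∀ x ∈ Kᗮ, ‖U.starProjection x‖ ≤ 2 * δ / lam * ‖x‖ := by
    intro x hx
    have h1 := hS x
    rw [apply_eq_zero_of_mem_range_orthogonal hT hx, sub_zero] at h1
    -- On `Kᗮ` the operator `S - c` is only the perturbation, of size `δ`, while on `U` it expands
    -- by at least `lam - δ ≥ lam / 2`.
    have h2 : (lam / 2 * ‖U.starProjection x‖) ^ 2 ≤ (δ * ‖x‖) ^ 2 := by
      calc _ = (lam / 2) ^ 2 * ‖U.starProjection x‖ ^ 2 := by ring
        _ ≤ ‖S x - c • x‖ ^ 2 := by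
          rw [← sum_sq_inner_eq u, ← sum_sq_inner_eq u, Finset.mul_sum]
          refine Finset.sum_le_sum fun i _ => ?_
          rw [inner_starProjection_span_image, inner_sub_right, inner_apply_eq_mul u hu,
            inner_smul_right]
          split_ifs with hi
          · have h3 := le_eigenvalue_of_lt_finrank_range u hβ hu hpos hS hi
            rw [← sub_mul, mul_pow]
            gcongr
            linarith
          · simpa using sq_nonneg _
        _ ≤ _ := by gcongr
    have h3 := abs_le_of_sq_le_sq h2 (by positivity)
    rw [abs_of_nonneg (by positivity)] at h3
    rw [div_mul_eq_mul_div, le_div_iff₀ hlam]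
    linarith
  have hran : ∀ x ∈ K, ‖U.starProjection x - x‖ ≤ 2 * δ / lam * ‖x‖ := by
    intro x hx
    obtain ⟨z, rfl⟩ := hx
    set y := K.starProjection z
    have hy : T z = T y := by
      have := apply_eq_zero_of_mem_range_orthogonal hT (K.sub_starProjection_mem_orthogonal z)
      rw [map_sub] at this
      exact sub_eq_zero.1 this
    rw [hy]
    have hnorm : lam * ‖y‖ ≤ ‖T y‖ := by
      by_cases hy0 : y = 0
      · simp [hy0]
      · have h3 := hpos y (K.starProjection_apply_mem z)
        have h4 := (abs_le.1 (abs_real_inner_le_norm (T y) y)).2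
        have h5 : 0 < ‖y‖ := norm_pos_iff.2 hy0
        exact le_of_mul_le_mul_right (by nlinarith) h5
    -- With `T y = (S - c) y - (S - T - c) y`, the projection off `U` bounds each term by `δ * ‖y‖`:
    -- the first because the remaining eigenvalues are within `δ` of `c`. Then `lam * ‖y‖ ≤ ‖T y‖`
    -- converts back to the vector `T y`.
    have h1 : T y - U.starProjection (T y) =
        ((S y - c • y) - U.starProjection (S y - c • y)) -
          ((S y - T y - c • y) - U.starProjection (S y - T y - c • y)) := by
      simp only [map_sub]; abel
    have hcontr : ∀ w : E, ‖w - U.starProjection w‖ ≤ ‖w‖ := by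
      intro w
      rw [← Submodule.starProjection_orthogonal_val]
      exact Submodule.norm_starProjection_apply_le _ _
    have h2 : ‖(S y - c • y) - U.starProjection (S y - c • y)‖ ≤ δ * ‖y‖ := by
      refine abs_le_of_sq_le_sq' ?_ (by positivity) |>.2
      rw [← sum_sq_inner_eq u, mul_pow, ← sum_sq_inner_eq u, Finset.mul_sum]
      refine Finset.sum_le_sum fun i _ => ?_
      rw [inner_sub_right, inner_starProjection_span_image, inner_sub_right,
        inner_apply_eq_mul u hu, inner_smul_right]
      split_ifs with hi
      · rw [sub_self]
        exact (zero_pow two_ne_zero).trans_le (by positivity)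
      · have h3 := abs_eigenvalue_sub_le_of_finrank_range_le u hβ hu hT hlam.le hpos hS
          (not_lt.1 hi)
        rw [sub_zero, ← sub_mul, mul_pow]
        exact mul_le_mul_of_nonneg_right (sq_le_sq' (abs_le.1 h3).1 (abs_le.1 h3).2)
          (sq_nonneg _)
    rw [norm_sub_rev, h1, div_mul_eq_mul_div, le_div_iff₀ hlam]
    have h3 := (hcontr (S y - T y - c • y)).trans (hS y)
    have h4 := norm_sub_le ((S y - c • y) - U.starProjection (S y - c • y))
      ((S y - T y - c • y) - U.starProjection (S y - T y - c • y))
    nlinarith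
  refine ContinuousLinearMap.opNorm_le_bound _ (by positivity) fun x => ?_
  have h1 : (U.starProjection - K.starProjection) x =
      (U.starProjection (K.starProjection x) - K.starProjection x) +
        U.starProjection (x - K.starProjection x) := by
    simp
  rw [h1]
  refine (norm_add_le _ _).trans ?_
  have h2 := hran _ (K.starProjection_apply_mem x)
  have h3 := hker _ (K.sub_starProjection_mem_orthogonal x)
  have h4 := K.norm_starProjection_apply_le x
  have h5 : ‖x - K.starProjection x‖ ≤ ‖x‖ := by
    rw [← Submodule.starProjection_orthogonal_val]
    exact Submodule.norm_starProjection_apply_le _ _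
  have h6 : 0 ≤ 2 * δ / lam := by positivity
  have h7 : 4 * δ / lam = 2 * δ / lam + 2 * δ / lam := by ring
  rw [h7]
  nlinarith

end Perturbation

/-! ### Nets of the unit ball and the operator norm. -/

section Net

variable {E : Type*} [NormedAddCommGroup E] [InnerProductSpace ℝ E]

variable (E) in
/-- The unit ball has a `1/2`-net of at most `5 ^ dim E` points. -/
theorem exists_half_net [FiniteDimensional ℝ E] : ∃ N : Finset E, N.card ≤ 5 ^ Module.finrank ℝ E ∧
    (∀ v ∈ N, ‖v‖ ≤ 1) ∧ ∀ x : E, ‖x‖ ≤ 1 → ∃ v ∈ N, ‖x - v‖ ≤ 1 / 2 := by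
  classical
  let p : Finset E → Prop := fun s => (∀ v ∈ s, ‖v‖ ≤ 1) ∧ ∀ c ∈ s, ∀ d ∈ s, c ≠ d → 1 / 2 ≤ ‖c - d‖
  have hp : ∀ s, p s → s.card ≤ 5 ^ Module.finrank ℝ E := by
    intro s hs
    -- Doubling gives a 1-separated set in the ball of radius 2, the normalization of
    -- `Besicovitch.card_le_of_separated`.
    have hinj : Function.Injective (fun x : E => (2 : ℝ) • x) :=
      smul_right_injective E two_ne_zero
    rw [← Finset.card_image_of_injective s hinj]
    refine Besicovitch.card_le_of_separated _ ?_ ?_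
    · simp only [Finset.mem_image]
      rintro _ ⟨v, hv, rfl⟩
      rw [norm_smul]
      have := hs.1 v hv
      norm_num
      linarith
    · simp only [Finset.mem_image]
      rintro _ ⟨v, hv, rfl⟩ _ ⟨w, hw, rfl⟩ hne
      rw [← smul_sub, norm_smul]
      have := hs.2 v hv w hw (fun h => hne (by rw [h]))
      norm_num
      linarith
  by_contra! hcon
  -- If no separated set were a net, each could be enlarged by an uncovered point, so separated sets
  -- of every size would exist.
  have hext : ∀ n : ℕ, ∃ s, p s ∧ s.card = n := by
    intro n
    induction n with
    | zero => exact ⟨∅, by simp [p], by simp⟩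
    | succ n ih =>
      obtain ⟨s, hs, hn⟩ := ih
      obtain ⟨x, hx, hxs⟩ := hcon s (hp s hs) hs.1
      have hxN : x ∉ s := by
        intro h
        have h1 := hxs x h
        rw [sub_self, norm_zero] at h1
        linarith
      refine ⟨insert x s, ⟨?_, ?_⟩, by rw [Finset.card_insert_of_notMem hxN, hn]⟩
      · intro v hv
        rcases Finset.mem_insert.1 hv with rfl | hv
        exacts [hx, hs.1 v hv]
      · intro c hc d hd hne
        rcases Finset.mem_insert.1 hc with hc | hc <;> rcases Finset.mem_insert.1 hd with hd | hd
        · exact absurd (hc.trans hd.symm) hne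
        · rw [hc]; exact (hxs d hd).le
        · rw [hd, norm_sub_rev]; exact (hxs c hc).le
        · exact hs.2 c hc d hd hne
  obtain ⟨s, hs, hn⟩ := hext (5 ^ Module.finrank ℝ E + 1)
  have := hp s hs
  omega

variable (E) in
/-- The unit ball has a `1/4`-net of at most `25 ^ dim E` points of norm at most `3/2`. -/
theorem exists_quarter_net [FiniteDimensional ℝ E] : ∃ N : Finset E, N.card ≤ 25 ^ Module.finrank ℝ E ∧
    (∀ v ∈ N, ‖v‖ ≤ 3 / 2) ∧ ∀ x : E, ‖x‖ ≤ 1 → ∃ v ∈ N, ‖x - v‖ ≤ 1 / 4 := by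
  classical
  obtain ⟨N, hcard, hN, hnet⟩ := exists_half_net E
  refine ⟨(N ×ˢ N).image fun p => p.1 + (1 / 2 : ℝ) • p.2, ?_, ?_, ?_⟩
  · refine Finset.card_image_le.trans ?_
    rw [Finset.card_product]
    calc _ ≤ 5 ^ Module.finrank ℝ E * 5 ^ Module.finrank ℝ E := Nat.mul_le_mul hcard hcard
      _ = _ := by rw [← mul_pow]; norm_num
  · simp only [Finset.mem_image, Finset.mem_product]
    rintro _ ⟨p, ⟨h1, h2⟩, rfl⟩
    refine (norm_add_le _ _).trans ?_
    rw [norm_smul]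
    have := hN _ h1
    have := hN _ h2
    norm_num
    linarith
  · intro x hx
    obtain ⟨y, hy, hxy⟩ := hnet x hx
    -- The residual, rescaled into the unit ball, is approximated by the same net.
    obtain ⟨z, hz, hyz⟩ := hnet ((2 : ℝ) • (x - y)) (by
      rw [norm_smul]; norm_num; linarith)
    refine ⟨_, Finset.mem_image.2 ⟨(y, z), Finset.mem_product.2 ⟨hy, hz⟩, rfl⟩, ?_⟩
    have h : x - (y + (1 / 2 : ℝ) • z) = (1 / 2 : ℝ) • ((2 : ℝ) • (x - y) - z) := by
      rw [smul_sub, smul_smul]; norm_num; abel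
    rw [h, norm_smul]
    norm_num
    linarith

/-- The norm of a symmetric operator is controlled by its quadratic form on a `1/4`-net. -/
theorem norm_apply_le_of_net {M : E →L[ℝ] E} (hM : (M : E →ₗ[ℝ] E).IsSymmetric) {N : Finset E}
    (hnet : ∀ x : E, ‖x‖ ≤ 1 → ∃ v ∈ N, ‖x - v‖ ≤ 1 / 4) {s : ℝ}
    (hs : ∀ v ∈ N, |inner ℝ (M v) v| ≤ s) (x : E) : ‖M x‖ ≤ 3 * s * ‖x‖ := by
  have hs0 : 0 ≤ s := by
    obtain ⟨v, hv, -⟩ := hnet 0 (by simp)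
    exact (abs_nonneg _).trans (hs v hv)
  have hball : ∀ x : E, ‖x‖ ≤ 1 → |inner ℝ (M x) x| ≤ s + 9 / 16 * ‖M‖ := by
    intro x hx
    obtain ⟨v, hv, hxv⟩ := hnet x hx
    have h1 : inner ℝ (M x) x = inner ℝ (M v) v + inner ℝ (M (x - v)) (x + v) := by
      have h2 : inner ℝ (M v) x = inner ℝ (M x) v := by
        rw [real_inner_comm]; exact (hM x v).symm
      simp only [map_sub, inner_sub_left, inner_add_right]
      rw [h2]; ring
    have h3 : ‖x + v‖ ≤ 9 / 4 := by
      have : x + v = (2 : ℝ) • x - (x - v) := by rw [two_smul]; abel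
      rw [this]
      refine (norm_sub_le _ _).trans ?_
      rw [norm_smul]
      norm_num
      linarith
    -- The factor must be below 1 to be absorbed. This is why mesh 1/4 is used: mesh 1/2 with points
    -- in the unit ball would give `1/2 * 2 = 1`.
    have h4 : |inner ℝ (M (x - v)) (x + v)| ≤ 9 / 16 * ‖M‖ :=
      calc _ ≤ ‖M (x - v)‖ * ‖x + v‖ := abs_real_inner_le_norm _ _
        _ ≤ (‖M‖ * (1 / 4)) * (9 / 4) := by
          gcongr
          exact M.le_of_opNorm_le_of_le le_rfl hxv
        _ = _ := by ring
    rw [h1]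
    exact (abs_add_le _ _).trans (add_le_add (hs v hv) h4)
  -- The norm of a symmetric operator is the supremum of its absolute Rayleigh quotients. Absorbing
  -- yields `16/7 * s`, rounded up to `3 * s`.
  have hle : ‖M‖ ≤ s + 9 / 16 * ‖M‖ := by
    refine (ContinuousLinearMap.norm_eq_iSup_rayleighQuotient M hM).trans_le ?_
    refine ciSup_le fun x => ?_
    by_cases hx : x = 0
    · simp [hx]; positivity
    have hx' : 0 < ‖x‖ := norm_pos_iff.2 hx
    have h := hball (‖x‖⁻¹ • x) (by rw [norm_smul]; simp [hx'.ne'])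
    rw [map_smul, inner_smul_left, inner_smul_right] at h
    have hq : M.rayleighQuotient x = ‖x‖⁻¹ * (‖x‖⁻¹ * inner ℝ (M x) x) := by
      simp only [ContinuousLinearMap.rayleighQuotient, ContinuousLinearMap.reApplyInnerSelf_apply,
        RCLike.re_to_real]
      field_simp
    rw [hq]
    exact h
  have h := M.le_opNorm x
  have h0 : ‖M‖ ≤ 3 * s := by linarith
  exact h.trans (by gcongr)

end Net

/-! ### Sub-gaussian moments, sub-exponential squares and Bernstein's inequality. -/

section MomentGenerating

variable {Ω : Type*} [MeasurableSpace Ω] {P : Measure Ω}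

theorem lintegral_pow_le_of_eLpNorm_le {Z : Ω → ℝ} {B : ℝ}
    (h : ∀ q : ℝ, 1 ≤ q → eLpNorm Z (ENNReal.ofReal q) P ≤ ENNReal.ofReal (B * √q))
    {j : ℕ} (hj : j ≠ 0) :
    ∫⁻ ω, ENNReal.ofReal ((Z ω ^ 2) ^ j) ∂P ≤ ENNReal.ofReal ((2 * B ^ 2 * j) ^ j) := by
  have hj1 : (1 : ℝ) ≤ j := by exact_mod_cast Nat.one_le_iff_ne_zero.2 hj
  have hq : (1 : ℝ) ≤ ((2 * j : ℕ) : ℝ) := by push_cast; linarith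
  have h1 := h _ hq
  rw [eLpNorm_eq_lintegral_rpow_enorm_toReal (by simp [hj]) ENNReal.ofReal_ne_top,
    ENNReal.toReal_ofReal (by positivity)] at h1
  have h2 : ∫⁻ ω, ENNReal.ofReal ((Z ω ^ 2) ^ j) ∂P =
      ∫⁻ ω, ‖Z ω‖ₑ ^ (((2 * j : ℕ) : ℝ)) ∂P := by
    refine lintegral_congr fun ω => ?_
    rw [ENNReal.rpow_natCast, ← ofReal_norm, ← ENNReal.ofReal_pow (norm_nonneg _),
      pow_mul, Real.norm_eq_abs, sq_abs]
  rw [h2]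
  have h3 := pow_le_pow_left' h1 (2 * j)
  rw [← ENNReal.rpow_natCast, ← ENNReal.rpow_mul, one_div_mul_cancel (by positivity),
    ENNReal.rpow_one] at h3
  refine h3.trans ?_
  by_cases hB : 0 ≤ B
  · rw [← ENNReal.ofReal_pow (by positivity)]
    refine ENNReal.ofReal_le_ofReal (le_of_eq ?_)
    rw [pow_mul, mul_pow, Real.sq_sqrt (by positivity)]
    push_cast
    ring
  · rw [ENNReal.ofReal_of_nonpos (mul_nonpos_of_nonpos_of_nonneg (not_le.1 hB).le
      (Real.sqrt_nonneg _)), zero_pow (by omega)]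
    exact zero_le

/-- The square of a sub-gaussian random variable has an exponential moment. -/
theorem lintegral_exp_sq_le_two [IsProbabilityMeasure P] {Z : Ω → ℝ} (hZ : Measurable Z) {B : ℝ}
    (hB : 0 < B)
    (h : ∀ q : ℝ, 1 ≤ q → eLpNorm Z (ENNReal.ofReal q) P ≤ ENNReal.ofReal (B * √q)) :
    ∫⁻ ω, ENNReal.ofReal (Real.exp (1 / (12 * B ^ 2) * Z ω ^ 2)) ∂P ≤ 2 := by
  -- The `j`-th term of the exponential series has mean at most `a^j (2B²j)^j / j!`. As `j^j / j! ≤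
  -- e^j ≤ 3^j`, it is at most `(6aB²)^j = 2^{-j}`.
  set a := 1 / (12 * B ^ 2)
  have ha : 0 < a := by positivity
  have hexp : ∀ ω, ENNReal.ofReal (Real.exp (a * Z ω ^ 2)) =
      ∑' j : ℕ, ENNReal.ofReal (a ^ j / j.factorial) * ENNReal.ofReal ((Z ω ^ 2) ^ j) := by
    intro ω
    rw [Real.exp_eq_exp_ℝ, NormedSpace.exp_eq_tsum_div,
      ENNReal.ofReal_tsum_of_nonneg (fun j => by positivity)
        (NormedSpace.expSeries_div_summable (a * Z ω ^ 2))]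
    refine tsum_congr fun j => ?_
    rw [← ENNReal.ofReal_mul (by positivity), mul_pow]
    congr 1
    ring
  simp_rw [hexp]
  rw [lintegral_tsum fun j => by fun_prop]
  calc _ ≤ ∑' j : ℕ, (2⁻¹ : ℝ≥0∞) ^ j := by
        refine ENNReal.tsum_le_tsum fun j => ?_
        rw [lintegral_const_mul _ (by fun_prop)]
        rcases eq_or_ne j 0 with rfl | hj
        · simp
        refine (mul_le_mul_right (lintegral_pow_le_of_eLpNorm_le h hj) _).trans ?_
        rw [← ENNReal.ofReal_mul (by positivity)]
        have h2 : (2⁻¹ : ℝ≥0∞) = ENNReal.ofReal 2⁻¹ := by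
          rw [ENNReal.ofReal_inv_of_pos two_pos]; simp
        rw [h2, ← ENNReal.ofReal_pow (by norm_num)]
        refine ENNReal.ofReal_le_ofReal ?_
        have h3 := Real.pow_div_factorial_le_exp (x := j) (by positivity) j
        have h4 : Real.exp j ≤ 3 ^ j := by
          rw [← Real.exp_one_pow]
          gcongr
          exact Real.exp_one_lt_three.le
        calc a ^ j / j.factorial * (2 * B ^ 2 * j) ^ j
            = (a * (2 * B ^ 2)) ^ j * ((j : ℝ) ^ j / j.factorial) := by
              rw [mul_pow, mul_pow a]; ring
          _ ≤ (a * (2 * B ^ 2)) ^ j * 3 ^ j := by gcongr; exact h3.trans h4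
          _ = 2⁻¹ ^ j := by
              rw [← mul_pow]
              congr 1
              simp only [a]
              field_simp
              norm_num
    _ = 2 := by rw [ENNReal.tsum_geometric, ENNReal.one_sub_inv_two, inv_inv]

/-- For `|x| ≤ 1` the Taylor remainder is at most `x²`; beyond that, `x² > 1` makes the last term
dominate. -/
theorem exp_le_one_add_add_sq_mul_exp_abs (x : ℝ) :
    Real.exp x ≤ 1 + x + x ^ 2 * Real.exp |x| := by
  have h1 : 1 ≤ Real.exp |x| := Real.one_le_exp (abs_nonneg x)
  by_cases hx : |x| ≤ 1
  · have h2 := (abs_le.1 (Real.abs_exp_sub_one_sub_id_le hx)).2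
    nlinarith [sq_nonneg x]
  · rcases lt_abs.1 (not_le.1 hx) with h | h
    · rw [abs_of_pos (by linarith)]
      have h2 : 0 ≤ (x ^ 2 - 1) * Real.exp x :=
        mul_nonneg (by nlinarith) (Real.exp_pos x).le
      linarith
    · have h2 : Real.exp x ≤ 1 := Real.exp_le_one_iff.2 (by linarith)
      nlinarith [sq_nonneg x]

/-- A nonnegative random variable with an exponential moment is sub-exponential. -/
theorem mgf_sub_integral_le [IsProbabilityMeasure P] {Q : Ω → ℝ} (hQ : Measurable Q)
    (hQ0 : ∀ ω, 0 ≤ Q ω) {a : ℝ} (ha : 0 < a)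
    (h : ∫⁻ ω, ENNReal.ofReal (Real.exp (a * Q ω)) ∂P ≤ 2) {t : ℝ} (ht : |t| ≤ a / 2) :
    Integrable Q P ∧ Integrable (fun ω => Real.exp (t * (Q ω - ∫ x, Q x ∂P))) P ∧
      mgf (fun ω => Q ω - ∫ x, Q x ∂P) P t ≤ Real.exp (16 / a ^ 2 * t ^ 2) := by
  have hae : Integrable (fun ω => Real.exp (a * Q ω)) P := by
    refine ⟨by fun_prop, ?_⟩
    rw [hasFiniteIntegral_iff_ofReal (ae_of_all _ fun ω => (Real.exp_pos _).le)]
    exact h.trans_lt (by simp)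
  have hle2 : ∫ ω, Real.exp (a * Q ω) ∂P ≤ 2 := by
    rw [integral_eq_lintegral_of_nonneg_ae (ae_of_all _ fun ω => (Real.exp_pos _).le)
      (by fun_prop)]
    exact ENNReal.toReal_le_of_le_ofReal (by norm_num) (by simpa using h)
  have hQi : Integrable Q P := by
    refine (hae.const_mul (1 / a)).mono' (by fun_prop) (ae_of_all _ fun ω => ?_)
    rw [Real.norm_of_nonneg (hQ0 ω)]
    have := Real.add_one_le_exp (a * Q ω)
    rw [div_mul_eq_mul_div, le_div_iff₀ ha]
    linarith
  have hti : Integrable (fun ω => Real.exp (t * Q ω)) P := by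
    refine hae.mono' (by fun_prop) (ae_of_all _ fun ω => ?_)
    rw [Real.norm_of_nonneg (Real.exp_pos _).le, Real.exp_le_exp]
    exact mul_le_mul_of_nonneg_right (by linarith [le_abs_self t]) (hQ0 ω)
  have hfac : ∀ ω, Real.exp (t * (Q ω - ∫ x, Q x ∂P)) =
      Real.exp (-(t * ∫ x, Q x ∂P)) * Real.exp (t * Q ω) := by
    intro ω
    rw [← Real.exp_add]
    congr 1
    ring
  refine ⟨hQi, by simpa only [hfac] using hti.const_mul _, ?_⟩
  -- Half of the exponent `a * Q` absorbs `Q²`, through `y²/2 ≤ e^y` at `y = aQ/2`; the other half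
  -- absorbs `e^{|tQ|}`, since `|t| ≤ a/2`.
  have hpt : ∀ ω, Real.exp (t * Q ω) ≤ 1 + t * Q ω + 8 / a ^ 2 * t ^ 2 * Real.exp (a * Q ω) := by
    intro ω
    refine (exp_le_one_add_add_sq_mul_exp_abs _).trans ?_
    have h1 := Real.quadratic_le_exp_of_nonneg (x := a / 2 * Q ω)
      (mul_nonneg (by positivity) (hQ0 ω))
    have h2 : 0 ≤ a / 2 * Q ω := mul_nonneg (by positivity) (hQ0 ω)
    have h3 : Q ω ^ 2 ≤ 8 / a ^ 2 * Real.exp (a / 2 * Q ω) := by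
      rw [div_mul_eq_mul_div, le_div_iff₀ (by positivity)]
      nlinarith
    have h4 : Real.exp |t * Q ω| ≤ Real.exp (a / 2 * Q ω) := by
      rw [abs_mul, abs_of_nonneg (hQ0 ω), Real.exp_le_exp]
      exact mul_le_mul_of_nonneg_right ht (hQ0 ω)
    have h5 : Real.exp (a * Q ω) = Real.exp (a / 2 * Q ω) * Real.exp (a / 2 * Q ω) := by
      rw [← Real.exp_add]; congr 1; ring
    have h6 : (t * Q ω) ^ 2 * Real.exp |t * Q ω| ≤ 8 / a ^ 2 * t ^ 2 * Real.exp (a * Q ω) :=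
      calc _ = t ^ 2 * (Q ω ^ 2 * Real.exp |t * Q ω|) := by ring
        _ ≤ t ^ 2 * ((8 / a ^ 2 * Real.exp (a / 2 * Q ω)) * Real.exp (a / 2 * Q ω)) := by gcongr
        _ = _ := by rw [h5]; ring
    linarith
  have hi1 : Integrable (fun ω => 1 + t * Q ω) P := (integrable_const _).add (hQi.const_mul t)
  have hint : ∫ ω, Real.exp (t * Q ω) ∂P ≤ 1 + (t * ∫ x, Q x ∂P) + 16 / a ^ 2 * t ^ 2 := by
    refine (integral_mono hti (hi1.add (hae.const_mul _)) hpt).trans ?_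
    rw [integral_add' hi1 (hae.const_mul _), integral_add (integrable_const _) (hQi.const_mul t),
      integral_const_mul, integral_const_mul]
    have h7 : 8 / a ^ 2 * t ^ 2 * ∫ ω, Real.exp (a * Q ω) ∂P ≤ 8 / a ^ 2 * t ^ 2 * 2 := by
      gcongr
    have h8 : 16 / a ^ 2 * t ^ 2 = 8 / a ^ 2 * t ^ 2 * 2 := by ring
    simp
    linarith
  rw [mgf]
  simp_rw [hfac]
  rw [integral_const_mul]
  calc _ ≤ Real.exp (-(t * ∫ x, Q x ∂P)) *
        Real.exp ((t * ∫ x, Q x ∂P) + 16 / a ^ 2 * t ^ 2) := by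
        gcongr
        refine hint.trans ?_
        have := Real.add_one_le_exp ((t * ∫ x, Q x ∂P) + 16 / a ^ 2 * t ^ 2)
        linarith
    _ = _ := by rw [← Real.exp_add]; congr 1; ring

/-- Chernoff's bound for sums of independent sub-exponential variables, upper tail. -/
theorem measureReal_le_sum_le {n : ℕ} {V : Fin n → Ω → ℝ} [IsProbabilityMeasure P]
    (hV : ∀ k, AEMeasurable (V k) P) (hind : iIndepFun V P) {c t s : ℝ} (ht : 0 ≤ t)
    (hint : ∀ k, Integrable (fun ω => Real.exp (t * V k ω)) P)
    (hmgf : ∀ k, mgf (V k) P t ≤ Real.exp c) :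
    P.real {ω | s ≤ ∑ k, V k ω} ≤ Real.exp (-t * s + n * c) := by
  have hsum := hind.mgf_sum₀ (t := t) hV Finset.univ
  have hpos : 0 < ∏ k, mgf (V k) P t := Finset.prod_pos fun k _ => mgf_pos (hint k)
  -- `mgf` takes the value 0 when the exponential is not integrable, whereas here it equals a
  -- product of positive factors.
  have hi : Integrable (fun ω => Real.exp (t * (∑ k, V k) ω)) P := by
    by_contra hcon
    rw [mgf_undef hcon] at hsum
    exact hpos.ne hsum
  have h1 := measure_ge_le_exp_mul_mgf s ht hi
  simp only [Finset.sum_apply] at h1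
  refine h1.trans ?_
  rw [hsum, Real.exp_add]
  gcongr
  calc _ ≤ ∏ _k : Fin n, Real.exp c :=
        Finset.prod_le_prod (fun k _ => mgf_nonneg) fun k _ => hmgf k
    _ = _ := by simp [Real.exp_nat_mul]

/-- Bernstein's inequality in the sub-gaussian regime. -/
theorem measureReal_le_abs_sum_le {n : ℕ} {V : Fin n → Ω → ℝ} [IsProbabilityMeasure P]
    (hV : ∀ k, AEMeasurable (V k) P) (hind : iIndepFun V P) {c t₀ s : ℝ} (hc : 0 < c)
    (h : ∀ t, |t| ≤ t₀ → ∀ k, Integrable (fun ω => Real.exp (t * V k ω)) P ∧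
      mgf (V k) P t ≤ Real.exp (c * t ^ 2)) (hs : 0 ≤ s) (hst : s ≤ 2 * c * t₀) :
    P.real {ω | n * s ≤ |∑ k, V k ω|} ≤ 2 * Real.exp (-(n * s ^ 2 / (4 * c))) := by
  -- The minimizer of `-t * s + c * t ^ 2`; the condition `s ≤ 2 * c * t₀` makes it admissible.
  set t := s / (2 * c)
  have ht0 : 0 ≤ t := by positivity
  have ht : |t| ≤ t₀ := by
    rw [abs_of_nonneg ht0, div_le_iff₀ (by positivity)]
    linarith
  have hexp : -t * (n * s) + n * (c * t ^ 2) = -(n * s ^ 2 / (4 * c)) := by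
    simp only [t]
    field_simp
    ring
  have h1 := measureReal_le_sum_le (s := n * s) hV hind ht0 (fun k => (h t ht k).1)
    (fun k => (h t ht k).2)
  have h2 := measureReal_le_sum_le (V := fun k ω => -V k ω) (s := n * s) (c := c * t ^ 2)
    (fun k => (hV k).neg) (hind.comp (fun _ x => -x) fun _ => measurable_neg) ht0
    (fun k => by
      simpa only [mul_neg, neg_mul] using (h (-t) (by rwa [abs_neg]) k).1)
    (fun k => by
      have := (h (-t) (by rwa [abs_neg]) k).2
      rw [neg_sq] at this
      simpa only [mgf, mul_neg, neg_mul] using this)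
  rw [hexp] at h1 h2
  have hsub : {ω | n * s ≤ |∑ k, V k ω|} ⊆
      {ω | n * s ≤ ∑ k, V k ω} ∪ {ω | n * s ≤ ∑ k, -V k ω} := by
    intro ω hω
    rw [Set.mem_ofPred_eq, le_abs] at hω
    simpa [Finset.sum_neg_distrib] using hω
  have h3 := (measureReal_mono hsub).trans (measureReal_union_le (μ := P) _ _)
  linarith

end MomentGenerating

/-! ### Second moment matrices and their quadratic forms. -/

section SecondMoment

variable {Ω : Type*} [MeasurableSpace Ω] {P : Measure Ω}

theorem eLpNorm_inner_le_of_psi2Norm_le {k : ℕ} {ξ : Ω → EuclideanSpace ℝ (Fin k)} {κ : ℝ}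
    (hκ : psi2Norm ξ P ≤ ENNReal.ofReal κ) (v : EuclideanSpace ℝ (Fin k)) {q : ℝ} (hq : 1 ≤ q) :
    eLpNorm (fun ω => inner ℝ (ξ ω) v) (ENNReal.ofReal q) P ≤ ENNReal.ofReal (κ * √q * ‖v‖) := by
  by_cases hv : v = 0
  · simp [hv]
  have hv' : 0 < ‖v‖ := norm_pos_iff.2 hv
  set w := ‖v‖⁻¹ • v
  have hw : ‖w‖ = 1 := by rw [norm_smul]; simp [hv'.ne']
  have h1 : ENNReal.ofReal (q ^ (-(1 / 2) : ℝ)) *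
      eLpNorm (fun ω => inner ℝ (ξ ω) w) (ENNReal.ofReal q) P ≤ ENNReal.ofReal κ := by
    refine le_trans ?_ hκ
    exact le_iSup₂_of_le w hw (le_iSup₂_of_le q hq le_rfl)
  have h2 : (fun ω => inner ℝ (ξ ω) v) = ‖v‖ • fun ω => inner ℝ (ξ ω) w := by
    ext ω
    simp only [Pi.smul_apply, smul_eq_mul, w, inner_smul_right]
    rw [mul_inv_cancel_left₀ hv'.ne']
  have h3 : √q * q ^ (-(1 / 2) : ℝ) = 1 := by
    rw [Real.sqrt_eq_rpow, ← Real.rpow_add (by linarith)]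
    norm_num
  have h4 : eLpNorm (fun ω => inner ℝ (ξ ω) w) (ENNReal.ofReal q) P ≤
      ENNReal.ofReal √q * ENNReal.ofReal κ := by
    refine le_trans (le_of_eq ?_) (mul_le_mul_right h1 (ENNReal.ofReal √q))
    rw [← mul_assoc, ← ENNReal.ofReal_mul (Real.sqrt_nonneg _), h3, ENNReal.ofReal_one, one_mul]
  rw [h2, eLpNorm_const_smul, ← ofReal_norm, norm_norm]
  refine (mul_le_mul_right h4 _).trans (le_of_eq ?_)
  rw [← ENNReal.ofReal_mul (Real.sqrt_nonneg _), ← ENNReal.ofReal_mul hv'.le]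
  congr 1
  ring

theorem memLp_two_of_psi2Norm_le {k : ℕ} {ξ : Ω → EuclideanSpace ℝ (Fin k)} {κ : ℝ}
    (hξ : Measurable ξ) (hκ : psi2Norm ξ P ≤ ENNReal.ofReal κ) : MemLp ξ 2 P := by
  refine MemLp.of_eval_piLp fun i => ⟨by fun_prop, ?_⟩
  have h := eLpNorm_inner_le_of_psi2Norm_le hκ (EuclideanSpace.single i 1) one_le_two
  rw [ENNReal.ofReal_ofNat] at h
  refine lt_of_le_of_lt (le_of_eq ?_) (h.trans_lt ENNReal.ofReal_lt_top)
  congr 1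
  ext ω
  rw [EuclideanSpace.inner_single_right]
  simp

theorem inner_secondMoment {k : ℕ} {ξ : Ω → EuclideanSpace ℝ (Fin k)} (hξ : MemLp ξ 2 P)
    (x y : EuclideanSpace ℝ (Fin k)) :
    inner ℝ (Matrix.toEuclideanLin (secondMoment ξ P) x) y =
      ∫ ω, inner ℝ (ξ ω) x * inner ℝ (ξ ω) y ∂P := by
  have hint : ∀ i j, Integrable (fun ω => ξ ω i * ξ ω j) P := fun i j =>
    (hξ.eval_piLp i).integrable_mul (hξ.eval_piLp j)
  have h1 : ∀ ω, inner ℝ (ξ ω) x * inner ℝ (ξ ω) y =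
      ∑ i, ∑ j, (x j * y i) * (ξ ω i * ξ ω j) := by
    intro ω
    simp only [PiLp.inner_apply, RCLike.inner_apply, conj_trivial]
    rw [Finset.sum_mul_sum, Finset.sum_comm]
    refine Finset.sum_congr rfl fun i _ => Finset.sum_congr rfl fun j _ => by ring
  simp_rw [h1]
  rw [integral_finsetSum _ fun i _ => integrable_finsetSum _ fun j _ => (hint i j).const_mul _]
  simp only [PiLp.inner_apply, RCLike.inner_apply, conj_trivial]
  refine Finset.sum_congr rfl fun i _ => ?_
  rw [integral_finsetSum _ fun j _ => (hint i j).const_mul _]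
  simp only [integral_const_mul, Matrix.ofLp_toLpLin, Matrix.toLin'_apply, Matrix.mulVec, dotProduct,
    secondMoment, Matrix.of_apply]
  rw [Finset.mul_sum]
  exact Finset.sum_congr rfl fun j _ => by ring

theorem isSymmetric_secondMoment {k : ℕ} (ξ : Ω → EuclideanSpace ℝ (Fin k)) :
    (Matrix.toEuclideanLin (secondMoment ξ P)).IsSymmetric := by
  refine Matrix.isSymmetric_toEuclideanLin_iff.2 (Matrix.IsHermitian.ext fun i j => ?_)
  simp [secondMoment, mul_comm]

theorem inner_empiricalCovariance {n m : ℕ} (y : Fin n → EuclideanSpace ℝ (Fin m))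
    (v : EuclideanSpace ℝ (Fin m)) :
    inner ℝ (Matrix.toEuclideanLin (empiricalCovariance y) v) v =
      (n : ℝ)⁻¹ * ∑ k, inner ℝ (y k) v ^ 2 := by
  have h1 : ∀ k, inner ℝ (y k) v ^ 2 = ∑ i, ∑ j, (v j * v i) * (y k i * y k j) := by
    intro k
    simp only [PiLp.inner_apply, RCLike.inner_apply, conj_trivial]
    rw [sq, Finset.sum_mul_sum]
    refine Finset.sum_congr rfl fun i _ => Finset.sum_congr rfl fun j _ => by ring
  simp_rw [h1]
  rw [Finset.sum_comm, Finset.mul_sum]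
  simp only [PiLp.inner_apply, RCLike.inner_apply, conj_trivial]
  refine Finset.sum_congr rfl fun i _ => ?_
  rw [Finset.sum_comm, Finset.mul_sum]
  simp only [Matrix.ofLp_toLpLin, Matrix.toLin'_apply, Matrix.mulVec, dotProduct, empiricalCovariance,
    Matrix.of_apply]
  rw [Finset.mul_sum]
  refine Finset.sum_congr rfl fun j _ => ?_
  rw [← Finset.mul_sum]
  ring

theorem isSymmetric_empiricalCovariance {n m : ℕ} (y : Fin n → EuclideanSpace ℝ (Fin m)) :
    (Matrix.toEuclideanLin (empiricalCovariance y)).IsSymmetric := by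
  refine Matrix.isSymmetric_toEuclideanLin_iff.2 (Matrix.IsHermitian.ext fun i j => ?_)
  simp [empiricalCovariance, mul_comm]

variable {m d : ℕ} {A : Matrix (Fin m) (Fin d) ℝ} {X : Ω → EuclideanSpace ℝ (Fin d)}

theorem inner_image {Ω : Type*} (A : Matrix (Fin m) (Fin d) ℝ) (X : Ω → EuclideanSpace ℝ (Fin d)) (ω : Ω)
    (v : EuclideanSpace ℝ (Fin m)) :
    inner ℝ (image A X ω) v = inner ℝ (X ω) ((Matrix.toEuclideanLin A).adjoint v) := by
  rw [LinearMap.adjoint_inner_right, image]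

theorem measurable_image (hX : Measurable X) : Measurable (image A X) :=
  ((Matrix.toEuclideanLin A).continuous_of_finiteDimensional).measurable.comp hX

theorem memLp_image (hX : MemLp X 2 P) : MemLp (image A X) 2 P :=
  (LinearMap.toContinuousLinearMap (Matrix.toEuclideanLin A)).comp_memLp' hX

/-- `Σ_{AX} = A Σ_X A*`, where `A*` is surjective because `A` is injective, so neither factor
changes the rank. -/
theorem finrank_range_secondMoment_image (hX : MemLp X 2 P)
    (hA : Function.Injective (Matrix.toEuclideanLin A)) :
    Module.finrank ℝ (LinearMap.range (Matrix.toEuclideanLin (secondMoment (image A X) P))) =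
      (secondMoment X P).rank := by
  set L := Matrix.toEuclideanLin A
  set S := Matrix.toEuclideanLin (secondMoment X P) with hS
  have h1 : Matrix.toEuclideanLin (secondMoment (image A X) P) = L ∘ₗ (S ∘ₗ L.adjoint) := by
    refine LinearMap.ext fun x => ext_inner_right ℝ fun y => ?_
    rw [inner_secondMoment (memLp_image hX), LinearMap.comp_apply, LinearMap.comp_apply,
      ← LinearMap.adjoint_inner_right, inner_secondMoment hX]
    simp only [inner_image]
    rfl
  have h2 : LinearMap.range L.adjoint = ⊤ := by
    rw [← Submodule.orthogonal_eq_bot_iff, LinearMap.orthogonal_range, LinearMap.adjoint_adjoint]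
    exact LinearMap.ker_eq_bot.2 hA
  rw [h1, LinearMap.range_comp, LinearMap.range_comp_of_range_eq_top _ h2,
    ← (Submodule.equivMapOfInjective L hA _).finrank_eq, hS, Matrix.toEuclideanLin_eq_toLin,
    ← Matrix.rank_eq_finrank_range_toLin]

end SecondMoment

/-! ### Moments of the datum. -/

section Model

variable {Ω : Type*} [MeasurableSpace Ω] {P : Measure Ω} {m d : ℕ}
  {A : Matrix (Fin m) (Fin d) ℝ} {σ : ℝ} {X : Ω → EuclideanSpace ℝ (Fin d)}
  {W : Ω → EuclideanSpace ℝ (Fin m)}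

theorem StandingAssumptions.memLp_X (h : StandingAssumptions A σ X W P) : MemLp X 2 P :=
  memLp_two_of_psi2Norm_le (κ := 1) h.measurable_X (by rw [h.psi2Norm_X, ENNReal.ofReal_one])

theorem StandingAssumptions.memLp_W (h : StandingAssumptions A σ X W P) : MemLp W 2 P :=
  memLp_two_of_psi2Norm_le h.measurable_W h.psi2Norm_W.le

theorem inner_observation {Ω : Type*} (A : Matrix (Fin m) (Fin d) ℝ) (σ : ℝ)
    (X : Ω → EuclideanSpace ℝ (Fin d)) (W : Ω → EuclideanSpace ℝ (Fin m)) (ω : Ω)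
    (v : EuclideanSpace ℝ (Fin m)) :
    inner ℝ (observation A σ X W ω) v = inner ℝ (image A X ω) v + σ * inner ℝ (W ω) v := by
  simp [observation, inner_add_left, inner_smul_left]

theorem StandingAssumptions.measurable_observation (h : StandingAssumptions A σ X W P) :
    Measurable (observation A σ X W) :=
  (measurable_image h.measurable_X).add (h.measurable_W.const_smul σ)

/-- The datum is sub-gaussian with constant `2`. -/
theorem StandingAssumptions.eLpNorm_inner_observation_le (h : StandingAssumptions A σ X W P)
    (v : EuclideanSpace ℝ (Fin m)) {q : ℝ} (hq : 1 ≤ q) :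
    eLpNorm (fun ω => inner ℝ (observation A σ X W ω) v) (ENNReal.ofReal q) P ≤
      ENNReal.ofReal (2 * ‖v‖ * √q) := by
  have hX := eLpNorm_inner_le_of_psi2Norm_le (κ := 1)
    (by rw [h.psi2Norm_X, ENNReal.ofReal_one]) ((Matrix.toEuclideanLin A).adjoint v) hq
  have hW := eLpNorm_inner_le_of_psi2Norm_le h.psi2Norm_W.le (σ • v) hq
  have hAv : ‖(Matrix.toEuclideanLin A).adjoint v‖ ≤ ‖v‖ := by
    have h1 := Matrix.l2_opNorm_mulVec A.conjTranspose v
    rw [Matrix.l2_opNorm_conjTranspose, h.norm_A, one_mul] at h1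
    rw [← Matrix.toEuclideanLin_conjTranspose_eq_adjoint]
    exact h1
  have hm1 := measurable_image (A := A) h.measurable_X
  have hm2 := h.measurable_W
  have hfun : (fun ω => inner ℝ (observation A σ X W ω) v) =
      (fun ω => inner ℝ (X ω) ((Matrix.toEuclideanLin A).adjoint v)) +
        fun ω => inner ℝ (W ω) (σ • v) := by
    ext ω
    rw [inner_observation, inner_image, Pi.add_apply, inner_smul_right]
  have hmX := h.measurable_X
  rw [hfun]
  refine (eLpNorm_add_le (by fun_prop) (by fun_prop) (by simpa using hq)).trans ?_
  refine (add_le_add hX hW).trans ?_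
  rw [← ENNReal.ofReal_add (by positivity) (by positivity)]
  refine ENNReal.ofReal_le_ofReal ?_
  rw [norm_smul, Real.norm_of_nonneg h.sigma_pos.le]
  have h3 : 1 / √2 * σ ≤ 1 := by
    rw [div_mul_eq_mul_div, one_mul, div_le_one (by positivity)]
    exact h.sigma_lt.le
  calc _ = √q * ‖(Matrix.toEuclideanLin A).adjoint v‖ + (1 / √2 * σ) * (√q * ‖v‖) := by ring
    _ ≤ √q * ‖v‖ + 1 * (√q * ‖v‖) := by gcongr
    _ = _ := by ring

/-- The second moment of the datum is `Σ_{AX} + σ² Σ_W`. -/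
theorem StandingAssumptions.integral_inner_observation_sq [IsProbabilityMeasure P]
    (h : StandingAssumptions A σ X W P) (hW : secondMoment W P = 1)
    (v : EuclideanSpace ℝ (Fin m)) :
    ∫ ω, inner ℝ (observation A σ X W ω) v ^ 2 ∂P =
      inner ℝ (Matrix.toEuclideanLin (secondMoment (image A X) P) v) v + σ ^ 2 * ‖v‖ ^ 2 := by
  have hAX := memLp_image (A := A) h.memLp_X
  have h1 : MemLp (fun ω => inner ℝ (image A X ω) v) 2 P := hAX.inner_const v
  have h2 : MemLp (fun ω => inner ℝ (W ω) v) 2 P := h.memLp_W.inner_const v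
  have hWW : ∫ ω, inner ℝ (W ω) v * inner ℝ (W ω) v ∂P = ‖v‖ ^ 2 := by
    rw [← inner_secondMoment h.memLp_W, hW]
    simp
  have hW0 : ∫ ω, inner ℝ (W ω) v ∂P = 0 := by
    simp_rw [real_inner_comm v]
    rw [integral_inner (h.memLp_W.integrable one_le_two), h.centered_W, inner_zero_right]
  -- Independence factors the mixed term, and centering of `W` alone makes it vanish; `X` need not
  -- be centered.
  have hcross : ∫ ω, inner ℝ (image A X ω) v * inner ℝ (W ω) v ∂P = 0 := by
    have hm : Measurable fun x : EuclideanSpace ℝ (Fin d) =>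
        (inner ℝ (Matrix.toEuclideanLin A x) v : ℝ) :=
      ((Matrix.toEuclideanLin A).continuous_of_finiteDimensional.measurable).inner_const
    have hind : IndepFun (fun ω => (inner ℝ (image A X ω) v : ℝ)) (fun ω => inner ℝ (W ω) v) P :=
      h.indep.comp hm (measurable_id.inner_const : Measurable fun x => (inner ℝ x v : ℝ))
    have h3 := hind.integral_mul_eq_mul_integral h1.1 h2.1
    rw [hW0, mul_zero] at h3
    exact h3
  have hexp : ∀ ω, inner ℝ (observation A σ X W ω) v ^ 2 =
      inner ℝ (image A X ω) v * inner ℝ (image A X ω) v +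
        2 * σ * (inner ℝ (image A X ω) v * inner ℝ (W ω) v) +
          σ ^ 2 * (inner ℝ (W ω) v * inner ℝ (W ω) v) := by
    intro ω
    rw [inner_observation]
    ring
  have hi1 : Integrable (fun ω => (inner ℝ (image A X ω) v * inner ℝ (image A X ω) v : ℝ)) P :=
    h1.integrable_mul h1
  have hi2 : Integrable
      (fun ω => 2 * σ * (inner ℝ (image A X ω) v * inner ℝ (W ω) v)) P :=
    (h1.integrable_mul h2).const_mul (2 * σ)
  have hi3 : Integrable (fun ω => σ ^ 2 * (inner ℝ (W ω) v * inner ℝ (W ω) v)) P :=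
    (h2.integrable_mul h2).const_mul (σ ^ 2)
  have hi12 : Integrable (fun ω => inner ℝ (image A X ω) v * inner ℝ (image A X ω) v +
      2 * σ * (inner ℝ (image A X ω) v * inner ℝ (W ω) v)) P := hi1.add hi2
  simp_rw [hexp]
  rw [integral_add hi12 hi3, integral_add hi1 hi2, integral_const_mul,
    integral_const_mul, hcross, hWW, inner_secondMoment hAX]
  ring

/-- Linear marginals of the datum have sub-exponential squares. -/
theorem StandingAssumptions.mgf_inner_observation_sq_le [IsProbabilityMeasure P]
    (h : StandingAssumptions A σ X W P) {v : EuclideanSpace ℝ (Fin m)} (hv : ‖v‖ ≤ 3 / 2) {t : ℝ}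
    (ht : |t| ≤ 1 / 216) :
    Integrable (fun ω => Real.exp (t * (inner ℝ (observation A σ X W ω) v ^ 2 -
        ∫ x, inner ℝ (observation A σ X W x) v ^ 2 ∂P))) P ∧
      mgf (fun ω => inner ℝ (observation A σ X W ω) v ^ 2 -
        ∫ x, inner ℝ (observation A σ X W x) v ^ 2 ∂P) P t ≤ Real.exp (186624 * t ^ 2) := by
  have hm := h.measurable_observation
  -- The constant 3 bounds `2 * ‖v‖` on the net. Hence `a = 1/108`, the range `a/2 = 1/216` and the
  -- variance factor `16/a² = 186624`.
  have h1 := lintegral_exp_sq_le_two (P := P)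
    (Z := fun ω => inner ℝ (observation A σ X W ω) v) (by fun_prop) (B := 3) (by norm_num)
    (fun q hq => (h.eLpNorm_inner_observation_le v hq).trans <| ENNReal.ofReal_le_ofReal <| by
      gcongr; linarith)
  have h2 := mgf_sub_integral_le (P := P)
    (Q := fun ω => inner ℝ (observation A σ X W ω) v ^ 2) (by fun_prop) (fun ω => sq_nonneg _)
    (by norm_num) h1 (t := t) (ht.trans (by norm_num))
  refine ⟨h2.2.1, h2.2.2.trans (le_of_eq ?_)⟩
  norm_num

end Model

/-! ### Concentration of the empirical covariance. -/

section Concentration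

variable {Ω₀ Ω : Type*} [MeasurableSpace Ω₀] {P₀ : Measure Ω₀} [IsProbabilityMeasure P₀]
  [MeasurableSpace Ω] {P : Measure Ω} [IsProbabilityMeasure P] {m d n : ℕ}
  {A : Matrix (Fin m) (Fin d) ℝ} {σ : ℝ} {X : Ω₀ → EuclideanSpace ℝ (Fin d)}
  {W : Ω₀ → EuclideanSpace ℝ (Fin m)} {Y : Fin n → Ω → EuclideanSpace ℝ (Fin m)}

/-- Bernstein with `c = 186624` and `t₀ = 1/216`; the limit on `s` is `2 * c * t₀ = 1728`. -/
theorem StandingAssumptions.measureReal_deviation_le (h : StandingAssumptions A σ X W P₀)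
    (hY : ∀ k, IdentDistrib (Y k) (observation A σ X W) P P₀) (hind : iIndepFun Y P)
    {v : EuclideanSpace ℝ (Fin m)} (hv : ‖v‖ ≤ 3 / 2) {s : ℝ} (hs0 : 0 ≤ s) (hs : s ≤ 1728) :
    P.real {ω | n * s ≤ |∑ k, (inner ℝ (Y k ω) v ^ 2 -
      ∫ x, inner ℝ (observation A σ X W x) v ^ 2 ∂P₀)|} ≤
        2 * Real.exp (-(n * s ^ 2 / (4 * 186624))) := by
  set μ := ∫ x, inner ℝ (observation A σ X W x) v ^ 2 ∂P₀
  have hg : Measurable fun y : EuclideanSpace ℝ (Fin m) => (inner ℝ y v ^ 2 - μ : ℝ) := by fun_prop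
  have hid : ∀ k, IdentDistrib (fun ω => inner ℝ (Y k ω) v ^ 2 - μ)
      (fun ω => inner ℝ (observation A σ X W ω) v ^ 2 - μ) P P₀ := fun k => (hY k).comp hg
  refine measureReal_le_abs_sum_le (fun k => (hid k).aemeasurable_fst)
    (hind.comp (fun _ y => inner ℝ y v ^ 2 - μ) fun _ => hg) (t₀ := 1 / 216) (by norm_num)
    (fun t ht k => ?_) hs0 (by linarith)
  have h1 := h.mgf_inner_observation_sq_le hv ht
  refine ⟨?_, ?_⟩
  · have h2 : IdentDistrib (fun ω => Real.exp (t * (inner ℝ (Y k ω) v ^ 2 - μ)))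
      (fun ω => Real.exp (t * (inner ℝ (observation A σ X W ω) v ^ 2 - μ))) P P₀ :=
      (hid k).comp (u := fun x => Real.exp (t * x)) (by fun_prop)
    exact h2.integrable_iff.2 h1.1
  · rw [mgf_congr_identDistrib (hid k)]
    exact h1.2

/-- Since `25 ≤ e⁴`, the net costs at most `e^{4m}`, which the `m` term of `4(√m + τ)²` pays for,
leaving `4τ² > τ²`. -/
theorem card_net_mul_exp_lt (m : ℕ) {τ : ℝ} (hτ : 0 < τ) :
    (25 : ℝ) ^ m * (2 * Real.exp (-(4 * (√(m : ℝ) + τ) ^ 2))) < 2 * Real.exp (-τ ^ 2) := by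
  have h1 : (25 : ℝ) ^ m ≤ Real.exp (4 * m) := by
    rw [mul_comm, Real.exp_nat_mul]
    gcongr
    have h2 := Real.exp_one_gt_d9
    have h3 : Real.exp 4 = Real.exp 1 ^ 4 := by rw [← Real.exp_nat_mul]; norm_num
    rw [h3]
    calc (25 : ℝ) ≤ 2.5 ^ 4 := by norm_num
      _ ≤ _ := by gcongr; linarith
  calc _ ≤ Real.exp (4 * m) * (2 * Real.exp (-(4 * (√(m : ℝ) + τ) ^ 2))) := by gcongr
    _ = 2 * Real.exp (4 * m + -(4 * (√(m : ℝ) + τ) ^ 2)) := by rw [Real.exp_add]; ring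
    _ < _ := by
      gcongr
      have h2 := Real.sq_sqrt (Nat.cast_nonneg (α := ℝ) m)
      have h3 : 0 ≤ √(m : ℝ) * τ := by positivity
      have h4 : 0 < τ ^ 2 := by positivity
      nlinarith

/-- With high probability, the empirical covariance matrix of the datum is close, in operator norm,
to its expectation. -/
theorem StandingAssumptions.exists_event_empiricalCovariance (h : StandingAssumptions A σ X W P₀)
    (hW : secondMoment W P₀ = 1)
    (hY : ∀ k, IdentDistrib (Y k) (observation A σ X W) P P₀) (hind : iIndepFun Y P)
    {τ : ℝ} (hτ : 0 < τ) (hn : 0 < n) (hsmall : (√(m : ℝ) + τ) / √(n : ℝ) ≤ 1) :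
    ∃ E : Set Ω, MeasurableSet E ∧ 1 - 2 * Real.exp (-τ ^ 2) < P.real E ∧
      ∀ ω ∈ E, ∀ x, ‖Matrix.toEuclideanLin (empiricalCovariance fun k => Y k ω) x -
        Matrix.toEuclideanLin (secondMoment (image A X) P₀) x - σ ^ 2 • x‖ ≤
          5184 * ((√(m : ℝ) + τ) / √(n : ℝ)) * ‖x‖ := by
  have hn' : (0 : ℝ) < n := by exact_mod_cast hn
  obtain ⟨N, hcard, hN, hnet⟩ := exists_quarter_net (EuclideanSpace ℝ (Fin m))
  rw [finrank_euclideanSpace_fin] at hcard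
  -- This level makes the Bernstein exponent exactly `4(√m + τ)²`, and `hsmall` keeps it at most
  -- 1728.
  set s := 1728 * ((√(m : ℝ) + τ) / √(n : ℝ)) with hs
  have hs0 : 0 ≤ s := by positivity
  have hexp : n * s ^ 2 / (4 * 186624) = 4 * (√(m : ℝ) + τ) ^ 2 := by
    rw [hs, mul_pow, div_pow, Real.sq_sqrt hn'.le]
    field_simp
    norm_num
  let B : EuclideanSpace ℝ (Fin m) → Set Ω := fun v =>
    {ω | n * s ≤ |∑ k, (inner ℝ (Y k ω) v ^ 2 -
      ∫ x, inner ℝ (observation A σ X W x) v ^ 2 ∂P₀)|}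
  have hB : ∀ v, NullMeasurableSet (B v) P := by
    intro v
    have hm : ∀ k, AEMeasurable (Y k) P := fun k => (hY k).aemeasurable_fst
    have hm' : AEMeasurable (fun ω => |∑ k, (inner ℝ (Y k ω) v ^ 2 -
        ∫ x, inner ℝ (observation A σ X W x) v ^ 2 ∂P₀)|) P := by fun_prop
    exact nullMeasurableSet_le aemeasurable_const hm'
  have hU : NullMeasurableSet (⋃ v ∈ N, B v) P :=
    N.nullMeasurableSet_biUnion fun v _ => hB v
  have hUle : P.real (⋃ v ∈ N, B v) < 2 * Real.exp (-τ ^ 2) := by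
    refine lt_of_le_of_lt ?_ (card_net_mul_exp_lt m hτ)
    calc P.real (⋃ v ∈ N, B v) ≤ ∑ v ∈ N, P.real (B v) := measureReal_biUnion_finset_le N B
      _ ≤ ∑ v ∈ N, 2 * Real.exp (-(4 * (√(m : ℝ) + τ) ^ 2)) := by
        refine Finset.sum_le_sum fun v hv => ?_
        rw [← hexp]
        exact h.measureReal_deviation_le hY hind (hN v hv) hs0 (by linarith)
      _ = N.card * (2 * Real.exp (-(4 * (√(m : ℝ) + τ) ^ 2))) := by
        rw [Finset.sum_const, nsmul_eq_mul]
      _ ≤ _ := by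
        gcongr
        exact_mod_cast hcard
  -- The sample is only a.e. measurable, so the good event is replaced by a measurable subset of the
  -- same measure.
  obtain ⟨E, hEsub, hE, hEeq⟩ := hU.compl.exists_measurable_subset_ae_eq
  refine ⟨E, hE, ?_, fun ω hω x => ?_⟩
  · rw [measureReal_congr hEeq, measureReal_compl₀ hU]
    simp
    linarith
  have hωB : ∀ v ∈ N, |∑ k, (inner ℝ (Y k ω) v ^ 2 -
      ∫ x, inner ℝ (observation A σ X W x) v ^ 2 ∂P₀)| < n * s := by
    intro v hv
    by_contra! hcon
    exact hEsub hω (Set.mem_biUnion hv hcon)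
  set T := Matrix.toEuclideanLin (secondMoment (image A X) P₀)
  set S := Matrix.toEuclideanLin (empiricalCovariance fun k => Y k ω)
  set M := S - T - σ ^ 2 • LinearMap.id
  have hM : M.IsSymmetric :=
    ((isSymmetric_empiricalCovariance _).sub (isSymmetric_secondMoment _)).sub
      (LinearMap.IsSymmetric.id.smul (by simp))
  have hquad : ∀ v ∈ N, |inner ℝ (LinearMap.toContinuousLinearMap M v) v| ≤ s := by
    intro v hv
    have h1 : inner ℝ (LinearMap.toContinuousLinearMap M v) v =
        (n : ℝ)⁻¹ * ∑ k, (inner ℝ (Y k ω) v ^ 2 -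
          ∫ x, inner ℝ (observation A σ X W x) v ^ 2 ∂P₀) := by
      rw [h.integral_inner_observation_sq hW, Finset.sum_sub_distrib, mul_sub,
        ← inner_empiricalCovariance]
      simp [M, inner_sub_left, inner_smul_left, S, T]
      field_simp
      ring
    rw [h1, abs_mul, abs_of_pos (inv_pos.2 hn'), inv_mul_le_iff₀ hn']
    exact (hωB v hv).le
  have hfin := norm_apply_le_of_net (M := LinearMap.toContinuousLinearMap M) (by simpa using hM)
    hnet hquad x
  calc _ = ‖LinearMap.toContinuousLinearMap M x‖ := by simp [M]
    _ ≤ _ := hfin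
    _ = _ := by rw [hs]; ring

end Concentration

end InverseProblem

/-! ### The theorem with explicit constants. -/

theorem theorem3p3 :
    ∃ C₁ C₂ : ℝ, 0 < C₁ ∧ 0 < C₂ ∧
      ∀ (m d n : ℕ)
        -- the model `Y = A X + σ W` with isotropic noise
        (Ω₀ : Type*) [MeasurableSpace Ω₀] (P₀ : Measure Ω₀) [IsProbabilityMeasure P₀]
        (A : Matrix (Fin m) (Fin d) ℝ) (σ : ℝ)
        (X : Ω₀ → EuclideanSpace ℝ (Fin d)) (W : Ω₀ → EuclideanSpace ℝ (Fin m))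
        (_ : InverseProblem.StandingAssumptions A σ X W P₀)
        (_ : InverseProblem.secondMoment W P₀ = 1)
        (lam : ℝ)
        (_ : InverseProblem.IsSmallestNonzeroEigenvalue
          (InverseProblem.secondMoment (InverseProblem.image A X) P₀) lam)
        -- the training set
        (Ω : Type*) [MeasurableSpace Ω] (P : Measure Ω) [IsProbabilityMeasure P]
        (Xs : Fin n → Ω → EuclideanSpace ℝ (Fin d)) (Ws : Fin n → Ω → EuclideanSpace ℝ (Fin m))
        (_ : ∀ k, IdentDistrib (fun ω => (Xs k ω, Ws k ω)) (fun ω => (X ω, W ω)) P P₀)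
        (_ : iIndepFun (fun k => InverseProblem.observation A σ (Xs k) (Ws k)) P)
        -- the empirical projection, for any choice of the leading eigenvectors
        (Pihat : Ω → EuclideanSpace ℝ (Fin m) →L[ℝ] EuclideanSpace ℝ (Fin m))
        (_ : ∀ ω, InverseProblem.IsLeadingEigenprojection
          (InverseProblem.empiricalCovariance
            fun k => InverseProblem.observation A σ (Xs k) (Ws k) ω)
          (InverseProblem.secondMoment X P₀).rank (Pihat ω))
        (τ : ℝ) (_ : 0 < τ)
        (_ : C₁ * ((√(m : ℝ) + τ) ^ 2 * max 1 (16 / lam ^ 2)) ≤ (n : ℝ))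
        (_ : σ ^ 2 < lam / 2),
        ∃ E : Set Ω, MeasurableSet E ∧ 1 - 2 * Real.exp (-τ ^ 2) < P.real E ∧
          ∀ ω ∈ E,
            ‖Pihat ω - InverseProblem.rangeProjection
                (InverseProblem.secondMoment (InverseProblem.image A X) P₀)‖
              ≤ C₂ * (1 / lam * (√((m : ℝ) / n) + τ / √(n : ℝ))) := by
  -- With `δ = 5184 r/√n`, the condition `δ ≤ lam/2` reads `2592 r · (4/lam) ≤ √n`, which gives
  -- `C₁`; the bound `4δ/lam` gives `C₂ = 4 · 5184`.
  refine ⟨2592 ^ 2, 20736, by norm_num, by norm_num, ?_⟩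
  intro m d n Ω₀ _ P₀ _ A σ X W h hW lam hlam Ω _ P _ Xs Ws hident hind Pihat hPihat τ hτ hn hσ
  have hlam0 : 0 < lam := by nlinarith [h.sigma_pos, sq_nonneg σ]
  set r := √(m : ℝ) + τ with hr
  have hr0 : 0 < r := by positivity
  have hn1 : (2592 * r) ^ 2 ≤ n := by
    have : (1 : ℝ) ≤ max 1 (16 / lam ^ 2) := le_max_left _ _
    refine le_trans ?_ hn
    rw [mul_pow]
    gcongr
    exact le_mul_of_one_le_right (by positivity) this
  have hn2 : (2592 * r * (4 / lam)) ^ 2 ≤ n := by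
    have : 16 / lam ^ 2 ≤ max 1 (16 / lam ^ 2) := le_max_right _ _
    refine le_trans ?_ hn
    calc _ = 2592 ^ 2 * (r ^ 2 * (16 / lam ^ 2)) := by ring
      _ ≤ _ := by gcongr
  have hn0 : (0 : ℝ) < n := lt_of_lt_of_le (by positivity) hn1
  have hsq : 0 < √(n : ℝ) := Real.sqrt_pos.2 hn0
  have hs1 : 2592 * r ≤ √(n : ℝ) := Real.le_sqrt_of_sq_le hn1
  have hs2 : 2592 * r * (4 / lam) ≤ √(n : ℝ) := Real.le_sqrt_of_sq_le hn2
  have hsmall : r / √(n : ℝ) ≤ 1 := by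
    rw [div_le_one hsq]
    linarith
  have hδ : 5184 * (r / √(n : ℝ)) ≤ lam / 2 := by
    rw [← mul_div_assoc, div_le_iff₀ hsq]
    rw [← mul_div_assoc, div_le_iff₀ hlam0] at hs2
    linarith
  have hobs : Measurable fun p : EuclideanSpace ℝ (Fin d) × EuclideanSpace ℝ (Fin m) =>
      Matrix.toEuclideanLin A p.1 + σ • p.2 :=
    ((Matrix.toEuclideanLin A).continuous_of_finiteDimensional.measurable.comp
      measurable_fst).add (measurable_snd.const_smul σ)
  obtain ⟨E, hE, hPE, hEω⟩ := h.exists_event_empiricalCovariance hW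
    (fun k => (hident k).comp hobs) hind hτ (by exact_mod_cast hn0) hsmall
  refine ⟨E, hE, hPE, fun ω hω => ?_⟩
  obtain ⟨u, β, hβ, hu, hQ⟩ := hPihat ω
  have hT := InverseProblem.isSymmetric_secondMoment (P := P₀) (InverseProblem.image A X)
  have hmain := InverseProblem.norm_starProjection_sub_le u hβ hu hT hlam0
    (fun x hx => InverseProblem.le_inner_apply_self_of_mem_range hT
      (fun t ht ht' => hlam.2 ⟨ht, ht'⟩) hx)
    (hEω ω hω) (by positivity) hδ
  rw [InverseProblem.finrank_range_secondMoment_image h.memLp_X h.injective_A, ← hQ] at hmain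
  refine hmain.trans (le_of_eq ?_)
  rw [Real.sqrt_div (Nat.cast_nonneg m)]
  ring
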